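/- Throughout, $E$ is a real Banach lattice with dual $E'$ and bidual $E''$. A functional $f\in E'$ is positive if $f(x)\ge 0$ for all $x\ge 0$, and $E$ has the positive Grothendieck property if every weak* null sequence of positive functionals in $E'$ is weakly null (that is, null for the topology $\sigma(E',E'')$). For an integer $k\ge 1$, a (continuous) $k$-homogeneous polynomial on $E$ is a function $P:E\to\mathbb R$ of the form $P(x)=A(x,\dots,x)$, where $A$ is a continuous symmetric $k$-linear form on $E$; this $A$ is unique. $P$ is positive if $A(x_1,\dots,x_k)\ge 0$ for all $x_1,\dots,x_k\ge 0$, and regular if it is the difference of two positive $k$-homogeneous polynomials; $\mathcal P^r({}^kE)$ denotes the set of regular ones. The Davie–Gamelin extension of $P$ is $\widetilde P:E''\to\mathbb R$, $\widetilde P(x'')=\widetilde A(x'',\dots,x'')$, where $$\widetilde A(x_1'',\dots,x_k'')=\lim_{x_1\to x_1''}\cdots\lim_{x_k\to x_k''}A(x_1,\dots,x_k),$$ an iterated limit in which each $x_j\in E$ tends to $x_j''$ in the weak* topology $\sigma(E'',E')$. Theorem. The following statements are equivalent. (1) $E$ has the positive Grothendieck property. (2) For every integer $k\ge 1$: whenever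 $(P_n)$ is a sequence of positive polynomials in $\mathcal P^r({}^kE)$ with $P_n(x)\to 0$ for all $x\in E$, then $\widetilde{P_n}(x'')\to 0$ for all $x''\in E''$. (3) For some integer $k\ge 1$: whenever $(P_n)$ is a sequence of positive polynomials in $\mathcal P^r({}^kE)$ with $P_n(x)\to 0$ for all $x\in E$, then $\widetilde{P_n}(x'')\to 0$ for all $x''\in E''$. -/

import Mathlib

open Filter Topology

noncomputable section

namespace BanachLatticePoly

section Functionals

variable {E : Type*} [NormedAddCommGroup E] [NormedSpace ℝ E] [Lattice E]

/-- A functional in the dual `E'` is positive if it is nonnegative on the positive cone. -/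
def IsPositiveFunctional (f : StrongDual ℝ E) : Prop :=
  ∀ x : E, 0 ≤ x → 0 ≤ f x

variable (E) in
/-- The positive Grothendieck property: every weak-star null sequence of positive functionals
in `E'` is weakly null. -/
def PositiveGrothendieckProperty : Prop :=
  ∀ f : ℕ → StrongDual ℝ E, (∀ n, IsPositiveFunctional (f n)) →
    Tendsto (fun n => StrongDual.toWeakDual (f n)) atTop (𝓝 0) →
    Tendsto (fun n => toWeakSpace ℝ (StrongDual ℝ E) (f n)) atTop (𝓝 0)

end Functionals

section Polynomials

variable (E : Type*) [NormedAddCommGroup E] [NormedSpace ℝ E]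

/-- Continuous `k`-homogeneous polynomials on `E`: functions of the form
`x ↦ A (x, …, x)` for some continuous symmetric `k`-linear form `A`. -/
structure HomogeneousPolynomial (k : ℕ) where
  /-- the underlying function -/
  toFun : E → ℝ
  exists_form : ∃ A : ContinuousMultilinearMap ℝ (fun _ : Fin k => E) ℝ,
    (∀ (σ : Equiv.Perm (Fin k)) (x : Fin k → E), A (fun i => x (σ i)) = A x) ∧
    ∀ x : E, toFun x = A (fun _ => x)

variable {E} {k : ℕ}

namespace HomogeneousPolynomial

instance : CoeFun (HomogeneousPolynomial E k) (fun _ => E → ℝ) := ⟨toFun⟩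

/-- The symmetric `k`-linear form associated with a `k`-homogeneous polynomial. -/
def form (P : HomogeneousPolynomial E k) :
    ContinuousMultilinearMap ℝ (fun _ : Fin k => E) ℝ :=
  P.exists_form.choose

theorem form_symm (P : HomogeneousPolynomial E k) (σ : Equiv.Perm (Fin k)) (x : Fin k → E) :
    P.form (fun i => x (σ i)) = P.form x :=
  P.exists_form.choose_spec.1 σ x

theorem apply_eq_form (P : HomogeneousPolynomial E k) (x : E) : P x = P.form (fun _ => x) :=
  P.exists_form.choose_spec.2 x

/-- The associated symmetric form is unique. -/
theorem form_unique (P : HomogeneousPolynomial E k)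
    (A : ContinuousMultilinearMap ℝ (fun _ : Fin k => E) ℝ)
    (hA : ∀ (σ : Equiv.Perm (Fin k)) (x : Fin k → E), A (fun i => x (σ i)) = A x)
    (hP : ∀ x : E, P x = A (fun _ => x)) : P.form = A := by
  have key : ∀ B : ContinuousMultilinearMap ℝ (fun _ : Fin k => E) ℝ,
      (∀ (σ : Equiv.Perm (Fin k)) (x : Fin k → E), B (fun i => x (σ i)) = B x) →
      (∀ x : E, P x = B (fun _ => x)) → ∀ v : Fin k → E,
      iteratedFDeriv ℝ k P.toFun 0 v = (k.factorial : ℝ) * B v := by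
    intro B hB hPB v
    have hfun : P.toFun = fun x => B (fun _ => x) := funext hPB
    rw [hfun, ContinuousMultilinearMap.iteratedFDeriv_comp_diagonal]
    simp [hB, Fintype.card_perm]
  ext v
  have h1 := key P.form P.form_symm P.apply_eq_form v
  have h2 := key A hA hP v
  have hk : (k.factorial : ℝ) ≠ 0 := by positivity
  exact mul_left_cancel₀ hk (h1.symm.trans h2)

section Order

variable [Lattice E]

/-- A homogeneous polynomial is positive if its associated symmetric form takes nonnegative
values on tuples of positive elements. -/
def IsPositive (P : HomogeneousPolynomial E k) : Prop :=
  ∀ x : Fin k → E, (∀ i, 0 ≤ x i) → 0 ≤ P.form x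

/-- A homogeneous polynomial is regular if it is a difference of two positive ones. -/
def IsRegular (P : HomogeneousPolynomial E k) : Prop :=
  ∃ Q R : HomogeneousPolynomial E k, Q.IsPositive ∧ R.IsPositive ∧ ∀ x : E, P x = Q x - R x

end Order

end HomogeneousPolynomial

/-- The filter on `E` of weak-star neighbourhoods in `E''` of `x'' ∈ E''`: a net in `E` converges
along it exactly when it converges weak-star to `x''`. -/
def weakStarFilter (x'' : StrongDual ℝ (StrongDual ℝ E)) : Filter E :=
  comap (fun x : E => StrongDual.toWeakDual (NormedSpace.inclusionInDoubleDual ℝ E x))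
    (𝓝 (StrongDual.toWeakDual x''))

/-- The value `A ↦ Ã (x₁'', …, xₖ'')` of the Davie–Gamelin (Aron–Berner) extension of a continuous
`k`-linear form `A` on `E`, as a bounded functional of `A`. It is the iterated limit
`lim_{x₁ → x₁''} ⋯ lim_{xₖ → xₖ''} A (x₁, …, xₖ)`, each `xᵢ ∈ E` tending weak-star to `xᵢ''`. The
outermost limit of the bounded functional `x₁ ↦ (A (x₁, ·))~ (x₂'', …, xₖ'')` on `E` is the value
of `x₁''` at that functional; see `tendsto_formExtension`. -/
def formExtension : (k : ℕ) → (Fin k → StrongDual ℝ (StrongDual ℝ E)) →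
    (ContinuousMultilinearMap ℝ (fun _ : Fin k => E) ℝ →L[ℝ] ℝ)
  | 0, _ => ContinuousMultilinearMap.apply ℝ (fun _ : Fin 0 => E) ℝ Fin.elim0
  | k + 1, x'' =>
      (x'' 0).comp
        ((ContinuousLinearMap.compL ℝ E (ContinuousMultilinearMap ℝ (fun _ : Fin k => E) ℝ) ℝ
            (formExtension k (Fin.tail x''))).comp
          (continuousMultilinearCurryLeftEquiv ℝ (fun _ : Fin (k + 1) => E)
            ℝ).toContinuousLinearEquiv.toContinuousLinearMap)

theorem formExtension_zero (x'' : Fin 0 → StrongDual ℝ (StrongDual ℝ E))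
    (A : ContinuousMultilinearMap ℝ (fun _ : Fin 0 => E) ℝ) :
    formExtension 0 x'' A = A Fin.elim0 := rfl

theorem formExtension_succ (x'' : Fin (k + 1) → StrongDual ℝ (StrongDual ℝ E))
    (A : ContinuousMultilinearMap ℝ (fun _ : Fin (k + 1) => E) ℝ) :
    formExtension (k + 1) x'' A =
      x'' 0 ((formExtension k (Fin.tail x'')).comp A.curryLeft) := rfl

/-- `E` is weak-star dense in `E''`, so limits along `weakStarFilter` are unique. -/
theorem weakStarFilter_neBot (x'' : StrongDual ℝ (StrongDual ℝ E)) :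
    (weakStarFilter x'').NeBot := by
  classical
  refine comap_neBot_iff.2 fun t ht => ?_
  have hind : IsInducing
      (fun (y : WeakDual ℝ (StrongDual ℝ E)) (f : StrongDual ℝ E) => y f) := ⟨rfl⟩
  rw [hind.nhds_eq_comap] at ht
  obtain ⟨U, hU, hUt⟩ := ht
  obtain ⟨V, hVU, hV, hxV⟩ := mem_nhds_iff.1 hU
  obtain ⟨I, u, hu, huV⟩ := isOpen_pi_iff.1 hV _ hxV
  let L : E →ₗ[ℝ] (I → ℝ) := LinearMap.pi fun f => (f : StrongDual ℝ E).toLinearMap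
  have hmem : (fun f : I => x'' f) ∈ LinearMap.range L := by
    by_contra hnot
    obtain ⟨g, hg, hle⟩ := Submodule.exists_le_ker_of_notMem hnot
    apply hg
    have hgen : ∀ v : I → ℝ, g v = ∑ f : I, v f * g (Pi.single f 1) := by
      intro v
      conv_lhs => rw [pi_eq_sum_univ' v]
      simp [map_sum]
    have hzero : ∑ f : I, g (Pi.single f 1) • (f : StrongDual ℝ E) = 0 := by
      ext x
      have hx : g (L x) = 0 := hle ⟨x, rfl⟩
      rw [hgen] at hx
      simpa [L, mul_comm] using hx
    rw [hgen]
    have := congrArg x'' hzero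
    simpa [map_sum, mul_comm] using this
  obtain ⟨x, hx⟩ := hmem
  refine ⟨x, hUt (hVU (huV fun f hf => ?_))⟩
  have h := congrFun hx ⟨f, hf⟩
  change f x ∈ u f
  have h' : f x = x'' f := h
  rw [h']
  exact (hu f hf).2

/-- The defining iterated limit of the extension. -/
theorem tendsto_formExtension (x'' : Fin (k + 1) → StrongDual ℝ (StrongDual ℝ E))
    (A : ContinuousMultilinearMap ℝ (fun _ : Fin (k + 1) => E) ℝ) :
    Tendsto (fun x : E => formExtension k (Fin.tail x'') (A.curryLeft x))
      (weakStarFilter (x'' 0)) (𝓝 (formExtension (k + 1) x'' A)) := by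
  rw [formExtension_succ]
  exact ((WeakDual.eval_continuous
    ((formExtension k (Fin.tail x'')).comp A.curryLeft)).tendsto
      (StrongDual.toWeakDual (x'' 0))).comp tendsto_comap

/-- The Davie–Gamelin extension `P̃ : E'' → ℝ` of a homogeneous polynomial `P` on `E`. -/
def HomogeneousPolynomial.davieGamelin (P : HomogeneousPolynomial E k)
    (x'' : StrongDual ℝ (StrongDual ℝ E)) : ℝ :=
  formExtension k (fun _ => x'') P.form

end Polynomials

end BanachLatticePoly

end

namespace BanachLatticePoly

section WeakTopologies

variable {F : Type*} [NormedAddCommGroup F] [NormedSpace ℝ F]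

theorem tendsto_toWeakDual_zero_iff {f : ℕ → StrongDual ℝ F} :
    Tendsto (fun n => StrongDual.toWeakDual (f n)) atTop (𝓝 0) ↔
      ∀ x, Tendsto (fun n => f n x) atTop (𝓝 0) := by
  have hind : IsInducing (fun (y : WeakDual ℝ F) (x : F) => y x) := ⟨rfl⟩
  exact hind.tendsto_nhds_iff.trans tendsto_pi_nhds

theorem tendsto_toWeakSpace_zero_iff {u : ℕ → F} :
    Tendsto (fun n => toWeakSpace ℝ F (u n)) atTop (𝓝 0) ↔
      ∀ g : StrongDual ℝ F, Tendsto (fun n => g (u n)) atTop (𝓝 0) := by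
  have hind : IsInducing
    (fun (y : WeakSpace ℝ F) (g : StrongDual ℝ F) => (topDualPairing ℝ F).flip y g) := ⟨rfl⟩
  refine hind.tendsto_nhds_iff.trans (tendsto_pi_nhds.trans (forall_congr' fun g => ?_))
  have h₀ : (topDualPairing ℝ F).flip (0 : F) g = 0 := map_zero g
  exact iff_of_eq (congrArg (fun c => Tendsto (fun n => g (u n)) atTop (𝓝 c)) h₀)

end WeakTopologies

section DualCone

variable {E : Type*} [NormedAddCommGroup E] [NormedSpace ℝ E] [Lattice E]

namespace IsPositiveFunctional

theorem zero : IsPositiveFunctional (0 : StrongDual ℝ E) := fun _ _ => le_rfl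

theorem add {f g : StrongDual ℝ E} (hf : IsPositiveFunctional f) (hg : IsPositiveFunctional g) :
    IsPositiveFunctional (f + g) := fun x hx => add_nonneg (hf x hx) (hg x hx)

theorem smul {f : StrongDual ℝ E} (hf : IsPositiveFunctional f) {c : ℝ} (hc : 0 ≤ c) :
    IsPositiveFunctional (c • f) := fun x hx => mul_nonneg hc (hf x hx)

variable [IsOrderedAddMonoid E]

theorem abs_apply_le {f : StrongDual ℝ E} (hf : IsPositiveFunctional f) (x : E) :
    |f x| ≤ f |x| := by
  have h₁ := hf (|x| - x) (sub_nonneg.2 (le_abs_self x))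
  have h₂ := hf (|x| + x) (by simpa using sub_nonneg.2 (neg_le_abs x))
  rw [map_sub] at h₁
  rw [map_add] at h₂
  exact abs_le.2 ⟨by linarith, by linarith⟩

/-- The dual norm is monotone on the cone of positive functionals. -/
theorem norm_le_norm_add [HasSolidNorm E] {f g : StrongDual ℝ E} (hf : IsPositiveFunctional f)
    (hg : IsPositiveFunctional g) : ‖f‖ ≤ ‖f + g‖ := by
  refine ContinuousLinearMap.opNorm_le_bound _ (norm_nonneg _) fun x => ?_
  calc ‖f x‖ ≤ f |x| := hf.abs_apply_le x
    _ ≤ (f + g) |x| := le_add_of_nonneg_right (hg _ (abs_nonneg x))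
    _ ≤ ‖(f + g) |x|‖ := Real.le_norm_self _
    _ ≤ ‖f + g‖ * ‖|x|‖ := (f + g).le_opNorm _
    _ = ‖f + g‖ * ‖x‖ := by rw [norm_abs_eq_norm]

end IsPositiveFunctional

/-- A bidual element `y''` dominates `x''` in modulus: `-y'' ≤ x'' ≤ y''`. -/
def Dominates (y'' x'' : StrongDual ℝ (StrongDual ℝ E)) : Prop :=
  ∀ f : StrongDual ℝ E, IsPositiveFunctional f → |x'' f| ≤ y'' f

theorem Dominates.abs_apply_le {y'' x'' : StrongDual ℝ (StrongDual ℝ E)} (h : Dominates y'' x'')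
    {f g : StrongDual ℝ E} (hfg : ∀ x, 0 ≤ x → |f x| ≤ g x) : |x'' f| ≤ y'' g := by
  have h₁ := h (g + f) fun x hx => by
    have := (abs_le.1 (hfg x hx)).1
    change 0 ≤ g x + f x
    linarith
  have h₂ := h (g - f) fun x hx => by
    have := (abs_le.1 (hfg x hx)).2
    change 0 ≤ g x - f x
    linarith
  rw [map_add, map_add, abs_le] at h₁
  rw [map_sub, map_sub, abs_le] at h₂
  exact abs_le.2 ⟨by linarith [h₁.1, h₂.2], by linarith [h₁.2, h₂.1]⟩

variable [IsOrderedAddMonoid E] [HasSolidNorm E]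

/-- The cone in `E' × ℝ` whose positive functionals extending the second projection correspond
to positive majorants of `x''` of norm at most `‖x''‖`. -/
def majorantCone (x'' : StrongDual ℝ (StrongDual ℝ E)) : PointedCone ℝ (StrongDual ℝ E × ℝ) where
  carrier := {p | ∃ g d : StrongDual ℝ E, IsPositiveFunctional g ∧ IsPositiveFunctional d ∧
    ‖x''‖ * ‖p.1 + (g + d)‖ ≤ p.2 + x'' g}
  zero_mem' := ⟨0, 0, .zero, .zero, by simp⟩
  smul_mem' := by
    rintro ⟨c, hc⟩ ⟨h, t⟩ ⟨g, d, hg, hd, hle⟩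
    refine ⟨c • g, c • d, hg.smul hc, hd.smul hc, ?_⟩
    change ‖x''‖ * ‖c • h + (c • g + c • d)‖ ≤ c * t + x'' (c • g)
    rw [← smul_add, ← smul_add, norm_smul, Real.norm_of_nonneg hc, map_smul, smul_eq_mul]
    have := mul_le_mul_of_nonneg_left hle hc
    simp only at this
    linarith
  add_mem' := by
    rintro p q ⟨g₁, d₁, hg₁, hd₁, hle₁⟩ ⟨g₂, d₂, hg₂, hd₂, hle₂⟩
    refine ⟨g₁ + g₂, d₁ + d₂, hg₁.add hg₂, hd₁.add hd₂, ?_⟩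
    have heq : p.1 + q.1 + (g₁ + g₂ + (d₁ + d₂)) = (p.1 + (g₁ + d₁)) + (q.1 + (g₂ + d₂)) := by
      abel
    have := mul_le_mul_of_nonneg_left
      (norm_add_le (p.1 + (g₁ + d₁)) (q.1 + (g₂ + d₂))) (norm_nonneg x'')
    rw [Prod.fst_add, Prod.snd_add, heq, map_add]
    linarith

theorem exists_positive_majorant (x'' : StrongDual ℝ (StrongDual ℝ E)) :
    ∃ w : StrongDual ℝ (StrongDual ℝ E), ∀ g d : StrongDual ℝ E,
      IsPositiveFunctional g → IsPositiveFunctional d → x'' g ≤ w (g + d) := by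
  have hne : ((0, 1) : StrongDual ℝ E × ℝ) ≠ 0 := by simp
  let φ : (StrongDual ℝ E × ℝ) →ₗ.[ℝ] ℝ := LinearPMap.mkSpanSingleton (0, 1) 1 hne
  have hmem (t : ℝ) : ((0, t) : StrongDual ℝ E × ℝ) ∈ φ.domain :=
    Submodule.mem_span_singleton.2 ⟨t, by simp⟩
  have hφ (t : ℝ) : φ ⟨(0, t), hmem t⟩ = t := by
    have hdom : t • ((0, 1) : StrongDual ℝ E × ℝ) ∈ φ.domain :=
      Submodule.mem_span_singleton.2 ⟨t, rfl⟩
    have h₁ : φ ⟨t • (0, 1), hdom⟩ = t • (1 : ℝ) :=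
      LinearPMap.mkSpanSingleton'_apply _ _ _ t hdom
    have h₂ : (⟨t • (0, 1), hdom⟩ : φ.domain) = ⟨(0, t), hmem t⟩ := Subtype.ext (by simp)
    rw [← h₂, h₁, smul_eq_mul, mul_one]
  have hnonneg : ∀ p : φ.domain, (p : StrongDual ℝ E × ℝ) ∈ majorantCone x'' → 0 ≤ φ p := by
    rintro ⟨p, hp⟩ ⟨g, d, hg, hd, hle⟩
    obtain ⟨t, rfl⟩ := Submodule.mem_span_singleton.1 hp
    have hp' : (⟨t • (0, 1), hp⟩ : φ.domain) = ⟨(0, t), hmem t⟩ := Subtype.ext (by simp)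
    rw [hp', hφ]
    have h₁ : x'' g ≤ ‖x''‖ * ‖g‖ := (Real.le_norm_self _).trans (x''.le_opNorm g)
    have h₂ := mul_le_mul_of_nonneg_left (hg.norm_le_norm_add hd) (norm_nonneg x'')
    simp only [Prod.smul_mk, smul_zero, zero_add, smul_eq_mul, mul_one] at hle
    linarith
  have hdense : ∀ y, ∃ p : φ.domain, (p : StrongDual ℝ E × ℝ) + y ∈ majorantCone x'' := by
    rintro ⟨h, s⟩
    exact ⟨⟨(0, ‖x''‖ * ‖h‖ - s), hmem _⟩, 0, 0, .zero, .zero, by simp⟩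
  obtain ⟨G, hG, hGpos⟩ := riesz_extension (majorantCone x'') φ hnonneg hdense
  have hG₂ (t : ℝ) : G (0, t) = t := (hG ⟨(0, t), hmem t⟩).trans (hφ t)
  have hsplit (h : StrongDual ℝ E) (t : ℝ) : G (h, t) = G (h, 0) + t := by
    rw [← hG₂ t, ← map_add, hG₂]
    simp
  have hbound (h : StrongDual ℝ E) : 0 ≤ G (h, 0) + ‖x''‖ * ‖h‖ := by
    rw [← hsplit]
    exact hGpos _ ⟨0, 0, .zero, .zero, by simp⟩
  let v : StrongDual ℝ E →ₗ[ℝ] ℝ := -(G.comp (LinearMap.inl ℝ (StrongDual ℝ E) ℝ))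
  have hv (h : StrongDual ℝ E) : v h = -G (h, 0) := rfl
  refine ⟨v.mkContinuous ‖x''‖ fun h => ?_, fun g d hg hd => ?_⟩
  · have h₁ := hbound h
    have h₂ := hbound (-h)
    have h₃ : v (-h) = -v h := map_neg v h
    rw [hv, hv] at h₃
    rw [norm_neg] at h₂
    rw [hv, Real.norm_eq_abs]
    exact abs_le.2 ⟨by linarith, by linarith⟩
  · have h₁ : 0 ≤ G (-(g + d), -x'' g) := hGpos _ ⟨g, d, hg, hd, by simp⟩
    have h₂ : v (-(g + d)) = -v (g + d) := map_neg v _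
    rw [hsplit] at h₁
    rw [hv] at h₂
    change x'' g ≤ v (g + d)
    linarith

/-- Every element of the bidual is dominated in modulus by some element of the bidual. -/
theorem exists_dominates (x'' : StrongDual ℝ (StrongDual ℝ E)) :
    ∃ y'' : StrongDual ℝ (StrongDual ℝ E), Dominates y'' x'' := by
  obtain ⟨w, hw⟩ := exists_positive_majorant x''
  refine ⟨(2 : ℝ) • w - x'', fun f hf => ?_⟩
  have h₁ := hw f 0 hf .zero
  have h₂ := hw 0 f .zero hf
  simp only [add_zero, zero_add, map_zero] at h₁ h₂
  change |x'' f| ≤ 2 * w f - x'' f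
  exact abs_le.2 ⟨by linarith, by linarith⟩

end DualCone

section PositiveForms

variable {E : Type*} [NormedAddCommGroup E] [NormedSpace ℝ E] [Lattice E] {k : ℕ}

/-- A multilinear form is positive if it is nonnegative on tuples of positive elements. -/
def IsPositiveForm (A : ContinuousMultilinearMap ℝ (fun _ : Fin k => E) ℝ) : Prop :=
  ∀ x : Fin k → E, (∀ i, 0 ≤ x i) → 0 ≤ A x

theorem IsPositiveForm.curryLeft {A : ContinuousMultilinearMap ℝ (fun _ : Fin (k + 1) => E) ℝ}
    (hA : IsPositiveForm A) {x : E} (hx : 0 ≤ x) : IsPositiveForm (A.curryLeft x) := fun v hv =>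
  hA (Fin.cons x v) fun i => Fin.cases hx hv i

theorem abs_formExtension_le {A : ContinuousMultilinearMap ℝ (fun _ : Fin k => E) ℝ}
    (hA : IsPositiveForm A) {x'' y'' : Fin k → StrongDual ℝ (StrongDual ℝ E)}
    (h : ∀ i, Dominates (y'' i) (x'' i)) : |formExtension k x'' A| ≤ formExtension k y'' A := by
  induction k with
  | zero =>
    rw [formExtension_zero, formExtension_zero]
    exact (abs_of_nonneg (hA _ fun i => i.elim0)).le
  | succ k ih =>
    rw [formExtension_succ, formExtension_succ]
    exact (h 0).abs_apply_le fun x hx => ih (hA.curryLeft hx) fun i => h i.succ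

theorem Dominates.self {y'' x'' : StrongDual ℝ (StrongDual ℝ E)} (h : Dominates y'' x'') :
    Dominates y'' y'' := fun f hf =>
  (abs_of_nonneg ((abs_nonneg _).trans (h f hf))).le

theorem IsPositiveForm.apply_le_apply_sum
    {A : ContinuousMultilinearMap ℝ (fun _ : Fin k => E) ℝ} (hA : IsPositiveForm A)
    {x : Fin k → E} (hx : ∀ i, 0 ≤ x i) : A x ≤ A fun _ => ∑ j, x j := by
  rw [A.map_sum (fun _ j => x j)]
  exact Finset.single_le_sum (f := fun r : Fin k → Fin k => A fun i => x (r i))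
    (fun r _ => hA _ fun i => hx _) (Finset.mem_univ id)

variable [IsOrderedAddMonoid E]

theorem tendsto_apply_zero_of_nonneg {f : ℕ → StrongDual ℝ E}
    (h : ∀ x, 0 ≤ x → Tendsto (fun n => f n x) atTop (𝓝 0)) (x : E) :
    Tendsto (fun n => f n x) atTop (𝓝 0) := by
  have := (h x⁺ (posPart_nonneg x)).sub (h x⁻ (negPart_nonneg x))
  simpa only [← map_sub, posPart_sub_negPart, sub_zero] using this

/-- The positive Grothendieck property in terms of evaluations. -/
theorem PositiveGrothendieckProperty.tendsto_apply (hE : PositiveGrothendieckProperty E)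
    {f : ℕ → StrongDual ℝ E} (hf : ∀ n, IsPositiveFunctional (f n))
    (h : ∀ x, 0 ≤ x → Tendsto (fun n => f n x) atTop (𝓝 0))
    (x'' : StrongDual ℝ (StrongDual ℝ E)) : Tendsto (fun n => x'' (f n)) atTop (𝓝 0) := by
  exact tendsto_toWeakSpace_zero_iff.1
    (hE f hf (tendsto_toWeakDual_zero_iff.2 (tendsto_apply_zero_of_nonneg h))) x''

theorem tendsto_formExtension_zero (hE : PositiveGrothendieckProperty E)
    {A : ℕ → ContinuousMultilinearMap ℝ (fun _ : Fin k => E) ℝ}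
    (hA : ∀ n, IsPositiveForm (A n))
    (h : ∀ x : Fin k → E, (∀ i, 0 ≤ x i) → Tendsto (fun n => A n x) atTop (𝓝 0))
    {x'' : Fin k → StrongDual ℝ (StrongDual ℝ E)} (hx'' : ∀ i, Dominates (x'' i) (x'' i)) :
    Tendsto (fun n => formExtension k x'' (A n)) atTop (𝓝 0) := by
  induction k with
  | zero => exact h _ fun i => i.elim0
  | succ k ih =>
    refine hE.tendsto_apply
      (f := fun n => (formExtension k (Fin.tail x'')).comp (A n).curryLeft)
      (fun n x hx => ?_) (fun x hx => ?_) (x'' 0)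
    · exact (abs_nonneg _).trans
        (abs_formExtension_le ((hA n).curryLeft hx) fun i => hx'' i.succ)
    · exact ih (fun n => (hA n).curryLeft hx)
        (fun v hv => h (Fin.cons x v) fun i => Fin.cases hx hv i) fun i => hx'' i.succ

theorem tendsto_davieGamelin_zero [HasSolidNorm E] (hE : PositiveGrothendieckProperty E)
    {P : ℕ → HomogeneousPolynomial E k} (hP : ∀ n, (P n).IsPositive)
    (h : ∀ x : E, Tendsto (fun n => P n x) atTop (𝓝 0))
    (x'' : StrongDual ℝ (StrongDual ℝ E)) :
    Tendsto (fun n => (P n).davieGamelin x'') atTop (𝓝 0) := by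
  obtain ⟨y'', hy''⟩ := exists_dominates x''
  refine squeeze_zero_norm (fun n => abs_formExtension_le (hP n) fun _ => hy'')
    (tendsto_formExtension_zero hE hP (fun x hx => ?_) fun _ => hy''.self)
  refine squeeze_zero (fun n => hP n x hx) (fun n => ?_) (h (∑ j, x j))
  rw [HomogeneousPolynomial.apply_eq_form]
  exact IsPositiveForm.apply_le_apply_sum (hP n) hx

end PositiveForms

section Powers

variable {E : Type*} [NormedAddCommGroup E] [NormedSpace ℝ E]

/-- The `k`-linear form `(x₁, …, xₖ) ↦ f x₁ ⋯ f xₖ`. -/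
def powForm (f : StrongDual ℝ E) (k : ℕ) : ContinuousMultilinearMap ℝ (fun _ : Fin k => E) ℝ :=
  (ContinuousMultilinearMap.mkPiAlgebra ℝ (Fin k) ℝ).compContinuousLinearMap fun _ => f

theorem powForm_apply (f : StrongDual ℝ E) {k : ℕ} (x : Fin k → E) :
    powForm f k x = ∏ i, f (x i) := by simp [powForm]

theorem powForm_symm (f : StrongDual ℝ E) {k : ℕ} (σ : Equiv.Perm (Fin k)) (x : Fin k → E) :
    powForm f k (fun i => x (σ i)) = powForm f k x := by
  simpa only [powForm_apply] using Equiv.prod_comp σ fun i => f (x i)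

theorem formExtension_powForm (f : StrongDual ℝ E) {k : ℕ}
    (x'' : Fin k → StrongDual ℝ (StrongDual ℝ E)) :
    formExtension k x'' (powForm f k) = ∏ i, x'' i f := by
  induction k with
  | zero => rw [formExtension_zero, powForm_apply]; simp
  | succ k ih =>
    have hcurry (x : E) : (powForm f (k + 1)).curryLeft x = f x • powForm f k := by
      ext v
      simp [powForm_apply, Fin.prod_univ_succ]
    have hcomp : (formExtension k (Fin.tail x'')).comp (powForm f (k + 1)).curryLeft
        = (∏ i, Fin.tail x'' i f) • f := by
      ext x
      simp [hcurry, ih, mul_comm]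
    rw [formExtension_succ, hcomp, map_smul, Fin.prod_univ_succ, smul_eq_mul, mul_comm]
    rfl

/-- The `k`-homogeneous polynomial `x ↦ f x ^ k`. -/
def powPolynomial (f : StrongDual ℝ E) (k : ℕ) : HomogeneousPolynomial E k where
  toFun x := f x ^ k
  exists_form := ⟨powForm f k, powForm_symm f, fun x => by simp [powForm_apply]⟩

theorem powPolynomial_form (f : StrongDual ℝ E) (k : ℕ) :
    (powPolynomial f k).form = powForm f k :=
  (powPolynomial f k).form_unique _ (powForm_symm f) fun x => by
    simp [powForm_apply, powPolynomial]

theorem davieGamelin_powPolynomial (f : StrongDual ℝ E) (k : ℕ)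
    (x'' : StrongDual ℝ (StrongDual ℝ E)) : (powPolynomial f k).davieGamelin x'' = x'' f ^ k := by
  rw [HomogeneousPolynomial.davieGamelin, powPolynomial_form, formExtension_powForm]
  simp

/-- The zero `k`-homogeneous polynomial. -/
def zeroPolynomial (E : Type*) [NormedAddCommGroup E] [NormedSpace ℝ E] (k : ℕ) :
    HomogeneousPolynomial E k where
  toFun _ := 0
  exists_form := ⟨0, fun _ _ => rfl, fun _ => rfl⟩

variable [Lattice E] {k : ℕ}

theorem zeroPolynomial_isPositive : (zeroPolynomial E k).IsPositive := fun x _ => by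
  rw [(zeroPolynomial E k).form_unique 0 (fun _ _ => rfl) fun _ => rfl]
  exact le_rfl

theorem HomogeneousPolynomial.IsPositive.isRegular {P : HomogeneousPolynomial E k}
    (hP : P.IsPositive) : P.IsRegular :=
  ⟨P, zeroPolynomial E k, hP, zeroPolynomial_isPositive, fun _ => (sub_zero _).symm⟩

theorem IsPositiveFunctional.powPolynomial_isPositive {f : StrongDual ℝ E}
    (hf : IsPositiveFunctional f) : (powPolynomial f k).IsPositive := fun x hx => by
  rw [powPolynomial_form, powForm_apply]
  exact Finset.prod_nonneg fun i _ => hf _ (hx i)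

theorem positiveGrothendieckProperty_of_polynomial (hk : 1 ≤ k)
    (h : ∀ P : ℕ → HomogeneousPolynomial E k,
      (∀ n, (P n).IsRegular) → (∀ n, (P n).IsPositive) →
      (∀ x : E, Tendsto (fun n => P n x) atTop (𝓝 0)) →
      ∀ x'' : StrongDual ℝ (StrongDual ℝ E),
        Tendsto (fun n => (P n).davieGamelin x'') atTop (𝓝 0)) :
    PositiveGrothendieckProperty E := by
  intro f hf hlim
  have hk₀ : k ≠ 0 := Nat.one_le_iff_ne_zero.1 hk
  have heval := tendsto_toWeakDual_zero_iff.1 hlim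
  have hpow := h (fun n => powPolynomial (f n) k)
    (fun n => (hf n).powPolynomial_isPositive.isRegular)
    (fun n => (hf n).powPolynomial_isPositive)
    fun x => by simpa [powPolynomial, hk₀] using (heval x).pow k
  refine tendsto_toWeakSpace_zero_iff.2 fun x'' => ?_
  have hx'' := hpow x''
  simp only [davieGamelin_powPolynomial] at hx''
  rw [tendsto_zero_iff_abs_tendsto_zero] at hx'' ⊢
  have hroot := hx''.rpow_const (p := (k : ℝ)⁻¹) (Or.inr (by positivity))
  rw [Real.zero_rpow (by positivity)] at hroot
  refine hroot.congr fun n => ?_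
  simp only [Function.comp_apply, abs_pow]
  exact Real.pow_rpow_inv_natCast (abs_nonneg _) hk₀

end Powers

end BanachLatticePoly

theorem mainTheorem6 {E : Type*} [NormedAddCommGroup E] [NormedSpace ℝ E] [CompleteSpace E]
    [Lattice E] [IsOrderedAddMonoid E] [IsOrderedModule ℝ E] [HasSolidNorm E] :
    List.TFAE [
      BanachLatticePoly.PositiveGrothendieckProperty E,
      ∀ k : ℕ, 1 ≤ k → ∀ P : ℕ → BanachLatticePoly.HomogeneousPolynomial E k,
        (∀ n, (P n).IsRegular) → (∀ n, (P n).IsPositive) →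
        (∀ x : E, Tendsto (fun n => P n x) atTop (𝓝 0)) →
        ∀ x'' : StrongDual ℝ (StrongDual ℝ E),
          Tendsto (fun n => (P n).davieGamelin x'') atTop (𝓝 0),
      ∃ k : ℕ, 1 ≤ k ∧ ∀ P : ℕ → BanachLatticePoly.HomogeneousPolynomial E k,
        (∀ n, (P n).IsRegular) → (∀ n, (P n).IsPositive) →
        (∀ x : E, Tendsto (fun n => P n x) atTop (𝓝 0)) →
        ∀ x'' : StrongDual ℝ (StrongDual ℝ E),
          Tendsto (fun n => (P n).davieGamelin x'') atTop (𝓝 0)] := by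
  tfae_have 1 → 2 := fun hE _ _ _ _ hpos hlim x'' =>
    BanachLatticePoly.tendsto_davieGamelin_zero hE hpos hlim x''
  tfae_have 2 → 3 := fun h => ⟨1, le_rfl, h 1 le_rfl⟩
  tfae_have 3 → 1 := fun ⟨_, hk, h⟩ =>
    BanachLatticePoly.positiveGrothendieckProperty_of_polynomial hk h
  tfae_finish
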